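/- **Theorem.** There is a nonempty compact Hausdorff space $X$ which is separable, has no weak P-points, and contains a dense set of $\mu$-points. More precisely, there is such a space $X$ with a countable, dense, dense-in-itself subset $H\subseteq X$ that is a P-set in $X$. Every non-atomic measure $\mu$ on $X$ satisfies $\mu(H)=0$ and, moreover, $\mu(U)=0$ for some open set $U\supseteq H$; every point of $H$ is a $\mu$-point. Here a *measure* on $X$ is a $\sigma$-additive Radon probability measure on the Borel sets of $X$ (inner regular with respect to compact sets and outer regular with respect to open sets); it is *non-atomic* if $\mu(\{x\})=0$ for every $x\in X$; its *support* is the intersection of all closed sets $C\subseteq X$ with $\mu(C)=1$. A point $x\in X$ is a *$\mu$-point* if it belongs to the support of no non-atomic measure on $X$, and a *weak P-point* if it is not a limit point of any countable subset of $X\setminus\{x\}$. A set $H\subseteq X$ is *dense-in-itself* if each of its points is a limit point of $H$, and a *P-set* if the intersection of any countable family of neighbourhoods of $H$ is a neighbourhood of $H$ ($H$ need not be closed). -/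

import Mathlib

open Set Topology Filter MeasureTheory TopologicalSpace

/-- A point `p` is a weak P-point if it is not a limit point of any countable subset of the
complement of `{p}`. -/
def IsWeakPPoint {X : Type*} [TopologicalSpace X] (p : X) : Prop :=
  ∀ C : Set X, C.Countable → C ⊆ {p}ᶜ → ¬ AccPt p (𝓟 C)

/-- A set `H` is a P-set if every countable intersection of neighbourhoods of `H` is again a
neighbourhood of `H`. The set `H` is not required to be closed. -/
def IsPSet {X : Type*} [TopologicalSpace X] (H : Set X) : Prop :=
  ∀ U : ℕ → Set X, (∀ n, U n ∈ 𝓝ˢ H) → (⋂ n, U n) ∈ 𝓝ˢ H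

/-- Radon probability measures: Borel probability measures that are inner regular with respect
to compact sets and outer regular with respect to open sets. -/
structure IsRadonProbability {X : Type*} [TopologicalSpace X] [MeasurableSpace X]
    (μ : Measure X) : Prop where
  prob : IsProbabilityMeasure μ
  inner : μ.InnerRegular
  outer : μ.OuterRegular

/-- Non-atomic Radon probability measures: every singleton is null (which is what `NullSingletonClass`
says). -/
structure IsNonatomicRadon {X : Type*} [TopologicalSpace X] [MeasurableSpace X]
    (μ : Measure X) : Prop extends IsRadonProbability μ where
  null_singletons : NullSingletonClass μ

/-- The support of a probability measure is the intersection of all closed sets of measure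
one. -/
theorem support_eq_sInter_measure_one {X : Type*} [TopologicalSpace X] [MeasurableSpace X]
    [BorelSpace X] (μ : Measure X) [IsProbabilityMeasure μ] :
    μ.support = ⋂₀ {C : Set X | IsClosed C ∧ μ C = 1} := by
  rw [Measure.support_eq_sInter]
  congr 1
  ext C
  exact and_congr_right fun hC => prob_compl_eq_zero_iff hC.measurableSet

/-- A `μ`-point is a point that lies in the support of no non-atomic (Radon probability)
measure. -/
def IsMuPoint {X : Type*} [TopologicalSpace X] [MeasurableSpace X] (x : X) : Prop :=
  ∀ μ : Measure X, IsNonatomicRadon μ → x ∉ μ.support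

/-! The space is the Stone–Čech compactification of the countable tree of finite sequences,
topologised so that each node is the limit of its immediate successors; `H` is the image of the
tree. A non-atomic measure kills the countable set `H`. If `H` is a P-set, outer regularity then
gives a null open set around `H`, so its points are `μ`-points.

The P-set property is a diagonal argument on the tree. Countably many neighbourhoods of `H` induce
countably many clopen covers of the tree. Around each node a clopen subtree can be pruned that meets
the `k`-th requirement except at finitely many nodes, for every `k` at once, so finitely many
members of each cover suffice for it. Closure commutes with finite unions, so its closure lies in
all the neighbourhoods. -/

/-- Finite sequences of natural numbers, the last entry written first, so that the immediate
successors of `t` are the sequences `n :: t`. -/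
def SeqTree : Type := List ℕ

namespace SeqTree

/-- The successor `n :: t` of `t`. -/
def succ (n : ℕ) (t : SeqTree) : SeqTree := List.cons n t

instance : Encodable SeqTree := inferInstanceAs (Encodable (List ℕ))

theorem succ_injective {m n : ℕ} {s t : SeqTree} (h : succ m s = succ n t) : m = n ∧ s = t :=
  List.cons.inj h

/-- A set is open if with every point it contains almost all of its immediate successors. -/
instance : TopologicalSpace SeqTree where
  IsOpen U := ∀ t ∈ U, ∀ᶠ n in cofinite, succ n t ∈ U
  isOpen_univ _ _ := Eventually.of_forall fun _ => mem_univ _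
  isOpen_inter _ _ hU hV t ht := (hU t ht.1).and (hV t ht.2)
  isOpen_sUnion S hS t := by
    rintro ⟨U, hU, ht⟩
    exact (hS U hU t ht).mono fun n hn => ⟨U, hU, hn⟩

theorem isOpen_iff {U : Set SeqTree} :
    IsOpen U ↔ ∀ t ∈ U, ∀ᶠ n in cofinite, succ n t ∈ U := Iff.rfl

theorem eventually_succ_mem_iff {C : Set SeqTree} (hC : IsClopen C) (t : SeqTree) :
    ∀ᶠ n in cofinite, (succ n t ∈ C ↔ t ∈ C) := by
  by_cases ht : t ∈ C
  · exact (isOpen_iff.1 hC.isOpen t ht).mono fun n hn => iff_of_true hn ht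
  · exact (isOpen_iff.1 hC.compl.isOpen t ht).mono fun n hn => iff_of_false hn ht

theorem tendsto_succ (t : SeqTree) : Tendsto (fun n => succ n t) cofinite (𝓝 t) := by
  rw [(nhds_basis_opens t).tendsto_right_iff]
  exact fun U hU => isOpen_iff.1 hU.2 t hU.1

/-- The subtree rooted at `r` in which the immediate successors of `t` are the `n :: t` with
`n ∈ A t`. -/
inductive Subtree (A : SeqTree → Set ℕ) (r : SeqTree) : SeqTree → Prop
  | root : Subtree A r r
  | succ {t : SeqTree} {n : ℕ} (ht : Subtree A r t) (hn : n ∈ A t) : Subtree A r (succ n t)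

/-- The complement is open because a node off the subtree has at most one successor in it, the root
`r`: every other member has its predecessor in the subtree. -/
theorem isClopen_subtree {A : SeqTree → Set ℕ} (hA : ∀ t, A t ∈ cofinite) (r : SeqTree) :
    IsClopen {t | Subtree A r t} := by
  refine ⟨⟨isOpen_iff.2 fun t ht => ?_⟩, isOpen_iff.2 fun t ht => ?_⟩
  · have hfin : {n | succ n t = r}.Subsingleton := fun m hm n hn =>
      (succ_injective (hm.trans hn.symm)).1
    filter_upwards [hfin.finite.compl_mem_cofinite] with n hn hsub
    generalize hu : succ n t = u at hsub
    cases hsub with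
    | root => exact hn hu
    | succ h _ => exact ht ((succ_injective hu).2 ▸ h)
  · filter_upwards [hA t] with n hn using Subtree.succ ht hn

theorem exists_isClopen_subset {U : Set SeqTree} (hU : IsOpen U) {r : SeqTree} (hr : r ∈ U) :
    ∃ C, IsClopen C ∧ r ∈ C ∧ C ⊆ U := by
  -- The implication keeps `A t` cofinite also for `t ∉ U`; such nodes are never reached from `r`.
  let A : SeqTree → Set ℕ := fun t => {n | t ∈ U → succ n t ∈ U}
  refine ⟨_, isClopen_subtree (A := A) (fun t => ?_) r, Subtree.root, fun t ht => ?_⟩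
  · by_cases ht : t ∈ U
    · filter_upwards [isOpen_iff.1 hU t ht] with n hn _ using hn
    · exact Eventually.of_forall fun n h => absurd h ht
  · induction ht with
    | root => exact hr
    | succ _ hn ih => exact hn ih

theorem exists_isClopen_separating {s t : SeqTree} (hst : s ≠ t) :
    ∃ C, IsClopen C ∧ s ∈ C ∧ t ∉ C := by
  have hU : IsOpen ({t}ᶜ : Set SeqTree) := by
    refine isOpen_iff.2 fun u _ => ?_
    have hfin : {n | succ n u = t}.Subsingleton := fun m hm n hn =>
      (succ_injective (hm.trans hn.symm)).1
    exact hfin.finite.compl_mem_cofinite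
  obtain ⟨C, hC, hs, hCt⟩ := exists_isClopen_subset hU (r := s) hst
  exact ⟨C, hC, hs, fun ht => hCt ht rfl⟩

/-- Countably many locally constant functions are simultaneously of finite range on some
neighbourhood of each point. -/
theorem exists_isClopen_finite_image {f : ℕ → SeqTree → ℕ}
    (hf : ∀ k t, ∀ᶠ n in cofinite, f k (succ n t) = f k t) (r : SeqTree) :
    ∃ T, IsClopen T ∧ r ∈ T ∧ ∀ k, (f k '' T).Finite := by
  -- Diagonalisation: at `t` only the functions with index at most the code of `t` are frozen. So `f
  -- k` can change only on stepping from one of the finitely many nodes with code below `k`, and the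
  -- successors of each node carry finitely many values.
  let A : SeqTree → Set ℕ := fun t => {n | ∀ k ∈ Iic (Encodable.encode t), f k (succ n t) = f k t}
  refine ⟨_, isClopen_subtree (A := A) (fun t => ?_) r, Subtree.root, fun k => ?_⟩
  · exact (eventually_all_finite (finite_Iic _)).2 fun k _ => hf k t
  · have hE : {t : SeqTree | Encodable.encode t < k}.Finite :=
      (finite_Iio k).preimage Encodable.encode_injective.injOn
    have hR : ∀ t, (range fun n => f k (succ n t)).Finite := fun t => by
      refine (((hf k t : Set.Finite _).image fun n => f k (succ n t)).insert (f k t)).subset ?_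
      rintro _ ⟨n, rfl⟩
      by_cases h : f k (succ n t) = f k t
      · exact Or.inl h
      · exact Or.inr ⟨n, h, rfl⟩
    refine ((hE.biUnion fun t _ => hR t).insert (f k r)).subset ?_
    rintro _ ⟨t, ht, rfl⟩
    induction ht with
    | root => exact Or.inl rfl
    | @succ t n _ hn ih =>
      by_cases hk : k ≤ Encodable.encode t
      · rw [hn k hk]
        exact ih
      · exact Or.inr (mem_biUnion (x := t) (not_le.1 hk) ⟨n, rfl⟩)

/-- For countably many clopen covers, each point has a clopen neighbourhood covered by finitely
many members of each of them. -/
theorem exists_isClopen_finite_subcovers {C : ℕ → SeqTree → Set SeqTree}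
    (hC : ∀ k t, IsClopen (C k t)) (hmem : ∀ k t, t ∈ C k t) (r : SeqTree) :
    ∃ T, IsClopen T ∧ r ∈ T ∧ ∀ k, ∃ F : Set SeqTree, F.Finite ∧ T ⊆ ⋃ u ∈ F, C k u := by
  classical
  have hex : ∀ k t, ∃ i, ∃ u, Encodable.encode u = i ∧ t ∈ C k u := fun k t =>
    ⟨_, t, rfl, hmem k t⟩
  -- The least code of a cover member containing `t` is decided by finitely many clopen sets, hence
  -- shared by almost all successors.
  have hf : ∀ k t, ∀ᶠ n in cofinite, Nat.find (hex k (succ n t)) = Nat.find (hex k t) := by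
    intro k t
    have hE : {u : SeqTree | Encodable.encode u ≤ Nat.find (hex k t)}.Finite :=
      (finite_Iic _).preimage Encodable.encode_injective.injOn
    filter_upwards [(eventually_all_finite hE).2 fun u _ => eventually_succ_mem_iff (hC k u) t]
      with n hn
    rw [Nat.find_eq_iff]
    refine ⟨?_, fun j hj => ?_⟩
    · obtain ⟨u, hu, htu⟩ := Nat.find_spec (hex k t)
      exact ⟨u, hu, (hn u hu.le).2 htu⟩
    · rintro ⟨u, rfl, htu⟩
      exact Nat.find_min (hex k t) hj ⟨u, rfl, (hn u hj.le).1 htu⟩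
  obtain ⟨T, hT, hr, hfin⟩ :=
    exists_isClopen_finite_image (f := fun k t => Nat.find (hex k t)) hf r
  refine ⟨T, hT, hr, fun k => ⟨_, (hfin k).preimage Encodable.encode_injective.injOn,
    fun t ht => ?_⟩⟩
  obtain ⟨u, hu, htu⟩ := Nat.find_spec (hex k t)
  exact mem_biUnion (x := u) ⟨t, ht, hu.symm⟩ htu

end SeqTree

/-- The closure of the image of a clopen set in the Stone–Čech compactification is a neighbourhood
of that image. -/
theorem IsClopen.closure_stoneCechUnit_image_mem_nhds {Y : Type*} [TopologicalSpace Y] {C : Set Y}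
    (hC : IsClopen C) {y : Y} (hy : y ∈ C) :
    closure (stoneCechUnit '' C) ∈ 𝓝 (stoneCechUnit y) := by
  -- The indicator of `C` extends to the compactification; by density, the open set where the
  -- extension is `true` lies in the closure of the image of `C`.
  have hcont := (continuous_boolIndicator_iff_isClopen C).2 hC
  have hO : IsOpen (stoneCechExtend hcont ⁻¹' {true}) :=
    (isOpen_discrete _).preimage (continuous_stoneCechExtend hcont)
  refine mem_of_superset (hO.mem_nhds ?_)
    ((denseRange_stoneCechUnit.open_subset_closure_inter hO).trans (closure_mono ?_))
  · rw [mem_preimage, stoneCechExtend_stoneCechUnit]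
    exact (mem_iff_boolIndicator C y).1 hy
  · rintro _ ⟨h, z, rfl⟩
    rw [mem_preimage, stoneCechExtend_stoneCechUnit] at h
    exact ⟨z, (mem_iff_boolIndicator C z).2 h, rfl⟩

namespace SeqTree

theorem stoneCechUnit_injective :
    Function.Injective (stoneCechUnit : SeqTree → StoneCech SeqTree) := by
  intro s t h
  by_contra hst
  obtain ⟨C, hC, hs, ht⟩ := exists_isClopen_separating hst
  have := eq_if_stoneCechUnit_eq ((continuous_boolIndicator_iff_isClopen C).2 hC) h
  rw [(mem_iff_boolIndicator C s).1 hs, (notMem_iff_boolIndicator C t).1 ht] at this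
  exact Bool.noConfusion this

theorem isPSet_range_stoneCechUnit :
    IsPSet (range (stoneCechUnit : SeqTree → StoneCech SeqTree)) := by
  intro U hU
  have key : ∀ k t, ∃ C : Set SeqTree, IsClopen C ∧ t ∈ C ∧
      closure (stoneCechUnit '' C) ⊆ U k := by
    intro k t
    obtain ⟨K, hK, hKc, hKU⟩ := exists_mem_nhds_isClosed_subset
      (mem_nhdsSet_iff_forall.1 (hU k) _ (mem_range_self t))
    obtain ⟨C, hC, ht, hCK⟩ := exists_isClopen_subset
      (isOpen_interior.preimage continuous_stoneCechUnit)
      (show t ∈ stoneCechUnit ⁻¹' interior K from mem_interior_iff_mem_nhds.2 hK)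
    refine ⟨C, hC, ht, (closure_minimal ?_ hKc).trans hKU⟩
    rintro _ ⟨s, hs, rfl⟩
    exact interior_subset (hCK hs)
  choose C hC hmem hCU using key
  rw [mem_nhdsSet_iff_forall]
  rintro _ ⟨r, rfl⟩
  obtain ⟨T, hT, hr, hcov⟩ := exists_isClopen_finite_subcovers hC hmem r
  refine mem_of_superset (hT.closure_stoneCechUnit_image_mem_nhds hr) (subset_iInter fun k => ?_)
  obtain ⟨F, hF, hTF⟩ := hcov k
  calc closure (stoneCechUnit '' T) ⊆ closure (⋃ u ∈ F, stoneCechUnit '' C k u) := by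
        rw [← image_iUnion₂]
        exact closure_mono (image_mono hTF)
    _ = ⋃ u ∈ F, closure (stoneCechUnit '' C k u) := hF.closure_biUnion _
    _ ⊆ U k := iUnion₂_subset fun u _ => hCU k u

theorem preperfect_range_stoneCechUnit :
    Preperfect (range (stoneCechUnit : SeqTree → StoneCech SeqTree)) := by
  rintro _ ⟨t, rfl⟩
  rw [accPt_iff_frequently]
  have htend := (continuous_stoneCechUnit.tendsto t).comp (tendsto_succ t)
  refine htend.frequently (Eventually.frequently (Eventually.of_forall fun n => ⟨fun h => ?_, ?_⟩))
  · exact List.cons_ne_self n t (stoneCechUnit_injective h)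
  · exact mem_range_self _

end SeqTree

/-- Outer regularity gives open sets around `H` of arbitrarily small measure; the P-set property
puts one open set inside countably many of them. -/
theorem IsPSet.exists_isOpen_measure_eq_zero {X : Type*} [TopologicalSpace X] [MeasurableSpace X]
    {H : Set X} (hH : IsPSet H) (μ : Measure X) [μ.OuterRegular] (hμ : μ H = 0) :
    ∃ U, IsOpen U ∧ H ⊆ U ∧ μ U = 0 := by
  have hpos : ∀ n : ℕ, μ H < ((n : ENNReal) + 1)⁻¹ := fun n => by
    rw [hμ]
    exact ENNReal.inv_pos.2 (by finiteness)
  choose V hHV hV hlt using fun n => H.exists_isOpen_lt_of_lt _ (hpos n)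
  obtain ⟨U, hU, hHU, hUV⟩ := mem_nhdsSet_iff_exists.1
    (hH V fun n => (hV n).mem_nhdsSet.2 (hHV n))
  refine ⟨U, hU, hHU, le_antisymm (le_of_forall_pos_le_add fun ε hε => ?_) zero_le⟩
  obtain ⟨n, hn⟩ := ENNReal.exists_inv_nat_lt hε.ne'
  rw [zero_add]
  calc μ U ≤ μ (V n) := measure_mono (hUV.trans (iInter_subset V n))
    _ ≤ ((n : ENNReal) + 1)⁻¹ := (hlt n).le
    _ ≤ (n : ENNReal)⁻¹ := ENNReal.inv_le_inv.2 le_self_add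
    _ ≤ ε := hn.le

/-- The witness is `H \ {x}`: it accumulates at `x` by preperfectness if `x ∈ H`, and by density
otherwise. -/
theorem not_isWeakPPoint_of_dense_preperfect {X : Type*} [TopologicalSpace X] {H : Set X}
    (hc : H.Countable) (hd : Dense H) (hp : Preperfect H) (x : X) : ¬ IsWeakPPoint x := by
  intro h
  refine h (H \ {x}) (hc.mono sdiff_subset) (fun y hy => hy.2) ?_
  rw [accPt_principal_iff_clusterPt, sdiff_sdiff, union_self]
  by_cases hx : x ∈ H
  · exact accPt_principal_iff_clusterPt.1 (hp x hx)
  · rw [sdiff_singleton_eq_self hx]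
    exact mem_closure_iff_clusterPt.1 (hd x)

theorem mainTheorem5 :
    ∃ (X : Type) (_ : TopologicalSpace X) (_ : MeasurableSpace X) (_ : BorelSpace X),
      Nonempty X ∧ CompactSpace X ∧ T2Space X ∧ SeparableSpace X ∧
      (∀ x : X, ¬ IsWeakPPoint x) ∧
      Dense {x : X | IsMuPoint x} ∧
      ∃ H : Set X, H.Countable ∧ Dense H ∧ Preperfect H ∧ IsPSet H ∧
        (∀ x ∈ H, IsMuPoint x) ∧
        (∀ μ : Measure X, IsNonatomicRadon μ →
          μ H = 0 ∧ ∃ U : Set X, IsOpen U ∧ H ⊆ U ∧ μ U = 0) := by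
  set H : Set (StoneCech SeqTree) := range stoneCechUnit
  let : MeasurableSpace (StoneCech SeqTree) := borel _
  have hc : H.Countable := countable_range _
  have hd : Dense H := denseRange_stoneCechUnit
  have hp : Preperfect H := SeqTree.preperfect_range_stoneCechUnit
  have hP : IsPSet H := SeqTree.isPSet_range_stoneCechUnit
  have hnull : ∀ μ : Measure (StoneCech SeqTree), IsNonatomicRadon μ →
      μ H = 0 ∧ ∃ U : Set (StoneCech SeqTree), IsOpen U ∧ H ⊆ U ∧ μ U = 0 := by
    intro μ hμ
    have := hμ.null_singletons
    have := hμ.outer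
    have h0 : μ H = 0 := hc.measure_zero μ
    exact ⟨h0, hP.exists_isOpen_measure_eq_zero μ h0⟩
  have hmu : ∀ x ∈ H, IsMuPoint x := by
    intro x hx μ hμ
    obtain ⟨-, U, hU, hHU, h0⟩ := hnull μ hμ
    exact Measure.notMem_support_iff_exists.2 ⟨U, hU.mem_nhds (hHU hx), h0⟩
  exact ⟨StoneCech SeqTree, inferInstance, borel _, ⟨rfl⟩,
    ⟨stoneCechUnit (List.nil : List ℕ)⟩, inferInstance, inferInstance, ⟨H, hc, hd⟩,
    not_isWeakPPoint_of_dense_preperfect hc hd hp, hd.mono hmu, H, hc, hd, hp, hP, hmu, hnull⟩
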